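/- Let $\mathcal H=(V,E)$ be a finite hypergraph on $n\ge 3$ vertices (a finite vertex set $V$ with a set $E$ of subsets of $V$, none of which is contained in another). For $i,k\ge 0$ let $\theta_{ik}$ be the number of pairs $(W,L)$ with $L\subseteq E$, $|L|=k$, $W=\bigcup_{\varepsilon\in L}\varepsilon$ and $|W|=i$, and let $S_{\mathcal H}(x,y)=\sum_{i,k}\theta_{ik}x^iy^k$. Let $\mathbb K$ be a field of characteristic $0$, $A=\mathbb K[x_v : v\in V]$, let $I_{\mathcal H}\subseteq A$ be the ideal generated by the monomials $\prod_{v\in\varepsilon}x_v$, $\varepsilon\in E$, and let $b_{ij}$ be the graded Betti numbers of $A/I_{\mathcal H}$: $b_{ij}$ is the number of summands $A(-\mathbf b)$ with $|\mathbf b|=j$ in homological degree $i$ of the minimal multigraded free resolution of $A/I_{\mathcal H}$. In the Betti table the entry $b_{ij}$ stands in column $i$ and row $j-i$, so that the anti-diagonals are the sets of entries $b_{ij}$ with $j$ fixed. Assume that each anti-diagonal of the Betti table contains at most one non-zero entry. Then for every $j\ge 0$: 1. the coefficient of $t^j$ in $S_{\mathcal H}(t,-1)$ is $\sum_k(-1)^k\theta_{jk}$;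 2. if $b_{ij}\neq 0$ (so that $b_{ij}$ is the non-zero entry of the $j$-th anti-diagonal), then $$b_{ij}=(-1)^i\sum_k(-1)^k\theta_{jk}=\Big|\sum_k(-1)^k\theta_{jk}\Big|;$$ 3. if $b_{ij}=0$ for all $i$, then $\sum_k(-1)^k\theta_{jk}=0$. -/

import Mathlib

/-- A finite hypergraph on the vertex type `V`: a finite set of subsets of `V` (the edges), no one
of which is contained in another. -/
structure FinHypergraph (V : Type*) where
  edges : Finset (Finset V)
  antichain : ∀ e₁ ∈ edges, ∀ e₂ ∈ edges, e₁ ⊆ e₂ → e₁ = e₂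

namespace FinHypergraph

/-- `θ i j` is the number of edge-induced subhypergraphs with `i` vertices and `j` edges. An
edge-induced subhypergraph is a pair `(W, L)` with `L` a set of edges and `W` the union of the
members of `L`. -/
def theta {V : Type*} [Fintype V] [DecidableEq V] (H : FinHypergraph V) (i j : ℕ) : ℕ :=
  (((Finset.univ : Finset (Finset V)) ×ˢ H.edges.powerset).filter
    fun p => p.1 = p.2.biUnion id ∧ p.1.card = i ∧ p.2.card = j).card

/-- The edge-induced subhypergraph polynomial `S_H(x, y) = ∑ θ_ij x^i y^j`, with `x = X 0` and
`y = X 1`. (`θ i j = 0` outside of the summation range.) -/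
noncomputable def edgePoly {V : Type*} [Fintype V] [DecidableEq V] (H : FinHypergraph V) :
    MvPolynomial (Fin 2) ℤ :=
  ∑ i ∈ Finset.range (Fintype.card V + 1), ∑ j ∈ Finset.range (H.edges.card + 1),
    (H.theta i j : MvPolynomial (Fin 2) ℤ) * MvPolynomial.X 0 ^ i * MvPolynomial.X 1 ^ j

/-- The univariate polynomial `S_H(t, -1)`. -/
noncomputable def edgePolyNegOne {V : Type*} [Fintype V] [DecidableEq V] (H : FinHypergraph V) :
    Polynomial ℤ :=
  MvPolynomial.aeval ![Polynomial.X, (-1 : Polynomial ℤ)] H.edgePoly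

/-- The edge ideal of `H` in `K[x_v : v ∈ V]`, generated by the squarefree monomials
`∏_{v ∈ e} x_v`, `e` an edge. -/
noncomputable def edgeIdeal {V : Type*} (K : Type*) [Field K] (H : FinHypergraph V) :
    Ideal (MvPolynomial V K) :=
  Ideal.span {f | ∃ e ∈ H.edges, f = ∏ v ∈ e, MvPolynomial.X v}

end FinHypergraph

/-- A minimal multigraded free resolution
`⋯ → F_2 → F_1 → F_0 → A/I → 0` of `A/I`, where `A = K[x_v : v ∈ V]`.
The module `F_i = ⨁_k A(-deg i k)` is free on the homogeneous basis vectors `Pi.single k 1`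
of multidegree `deg i k`, `k : Fin (rank i)`. -/
structure MinimalFreeResolution {V K : Type*} [Field K] (I : Ideal (MvPolynomial V K)) where
  rank : ℕ → ℕ
  deg : ∀ i, Fin (rank i) → V →₀ ℕ
  /-- The differential `F_{i+1} → F_i`. -/
  d : ∀ i, (Fin (rank (i + 1)) → MvPolynomial V K) →ₗ[MvPolynomial V K]
    (Fin (rank i) → MvPolynomial V K)
  /-- The augmentation `F_0 → A/I`. -/
  aug : (Fin (rank 0) → MvPolynomial V K) →ₗ[MvPolynomial V K] (MvPolynomial V K ⧸ I)
  /-- The differentials preserve multidegrees: a monomial `x^m` that occurs in the `l`-th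
  coordinate of the image of the `k`-th basis vector satisfies `m + deg l = deg k`. -/
  d_homogeneous : ∀ i k l, ∀ m ∈ (d i (Pi.single k 1) l).support, m + deg i l = deg (i + 1) k
  /-- The augmentation preserves multidegrees. -/
  aug_homogeneous : ∀ k, ∃ c : K,
    aug (Pi.single k 1) = Ideal.Quotient.mk I (MvPolynomial.monomial (deg 0 k) c)
  aug_surjective : Function.Surjective aug
  exact_zero : Function.Exact (d 0) aug
  exact_succ : ∀ i, Function.Exact (d (i + 1)) (d i)
  /-- Minimality: the image of each differential lies in `𝔪 F_i`, with `𝔪` the ideal generated by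
  the variables. -/
  minimal : ∀ i x l, d i x l ∈ Ideal.span (Set.range (MvPolynomial.X : V → MvPolynomial V K))

namespace MinimalFreeResolution

/-- The multigraded Betti number `b_{i,𝐛}`: the number of summands `A(-𝐛)` of `F_i`. -/
def multigradedBetti {V K : Type*} [DecidableEq V] [Field K] {I : Ideal (MvPolynomial V K)}
    (F : MinimalFreeResolution I) (i : ℕ) (b : V →₀ ℕ) : ℕ :=
  (Finset.univ.filter fun k => F.deg i k = b).card

/-- The graded Betti number `b_{ij} = ∑_{|𝐛| = j} b_{i,𝐛}`. -/
noncomputable def betti {V K : Type*} [Fintype V] [DecidableEq V] [Field K]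
    {I : Ideal (MvPolynomial V K)} (F : MinimalFreeResolution I) (i j : ℕ) : ℕ :=
  ∑ b ∈ Finset.finsuppAntidiag (Finset.univ : Finset V) j, F.multigradedBetti i b

end MinimalFreeResolution

/-! In a fixed multidegree `b` the resolution is an exact complex of finite-dimensional `K`-spaces,
and `F_i` contributes one dimension for each generator of multidegree at most `b`. Its Euler
characteristic is the dimension of `(A/I)_b`: 0 if the support of `b` contains an edge, else 1
(`sum_neg_one_pow_mul_card_deg_le`). The signed count of edge sets with union inside the support of
`b` has the same value (`sum_signedCovers`).

Both quantities are sums over all `a ≤ b`, so Möbius inversion equates the terms: `∑ (-1)^i b_{i,b}`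
is the signed count of edge sets with union exactly `b` (`sum_multigradedBetti_eq_signedCovers`).
Summing over `|b| = j` gives the coefficient of `t^j`; the anti-diagonal hypothesis leaves at most
one Betti number in the alternating sum. -/

open MvPolynomial

/-! ### Multigraded strands of free modules -/

section GradedPiece

variable {V K ι κ : Type*} [Field K]

variable (K) in
/-- The homogeneous elements of multidegree `b` of the free module `⨁_k A(-deg k)`. -/
def gradedPiece (deg : ι → V →₀ ℕ) (b : V →₀ ℕ) :
    Submodule K (ι → MvPolynomial V K) where
  carrier := {x | ∀ k m, coeff m (x k) ≠ 0 → m + deg k = b}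
  zero_mem' := by intro k m h; simp at h
  add_mem' := by
    intro x y hx hy k m h
    by_cases h0 : coeff m (x k) = 0
    · refine hy k m fun h1 => h ?_
      simp [h0, h1]
    · exact hx k m h0
  smul_mem' := by
    intro c x hx k m h
    refine hx k m fun h1 => h ?_
    simp [h1]

variable (K) in
open Classical in
/-- The projection of `⨁_k A(-deg k)` onto its homogeneous part of multidegree `b`. -/
noncomputable def degreeProj (deg : ι → V →₀ ℕ) (b : V →₀ ℕ) :
    (ι → MvPolynomial V K) →ₗ[K] (ι → MvPolynomial V K) :=
  LinearMap.pi fun k =>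
    if deg k ≤ b then
      (monomial (b - deg k)).comp ((lcoeff K (b - deg k)).comp (LinearMap.proj k))
    else 0

open Classical in
theorem coeff_degreeProj (deg : ι → V →₀ ℕ) (b m : V →₀ ℕ) (x : ι → MvPolynomial V K) (k : ι) :
    coeff m (degreeProj K deg b x k) = if m + deg k = b then coeff m (x k) else 0 := by
  rw [degreeProj, LinearMap.pi_apply]
  by_cases h : deg k ≤ b
  · have key : b - deg k = m ↔ m + deg k = b :=
      ⟨fun e => by rw [← e, tsub_add_cancel_of_le h], fun e => by rw [← e, add_tsub_cancel_right]⟩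
    simp only [h, if_true, LinearMap.comp_apply, LinearMap.proj_apply, lcoeff_apply,
      coeff_monomial, key]
    split_ifs with h1
    · rw [key.2 h1]
    · rfl
  · have : m + deg k ≠ b := fun e => h (e ▸ le_add_self)
    simp [h, this]

theorem degreeProj_mem (deg : ι → V →₀ ℕ) (b : V →₀ ℕ) (x : ι → MvPolynomial V K) :
    degreeProj K deg b x ∈ gradedPiece K deg b := by
  classical
  intro k m h
  rw [coeff_degreeProj] at h
  by_contra h1
  simp [h1] at h

theorem degreeProj_of_mem {deg : ι → V →₀ ℕ} {b : V →₀ ℕ} {x : ι → MvPolynomial V K}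
    (hx : x ∈ gradedPiece K deg b) : degreeProj K deg b x = x := by
  classical
  ext k m
  rw [coeff_degreeProj]
  split_ifs with h
  · rfl
  · by_contra h1
    exact h (hx k m (Ne.symm h1))

theorem degreeProj_of_mem_of_ne {deg : ι → V →₀ ℕ} {b b' : V →₀ ℕ} (hb : b' ≠ b)
    {x : ι → MvPolynomial V K} (hx : x ∈ gradedPiece K deg b') : degreeProj K deg b x = 0 := by
  classical
  ext k m
  rw [coeff_degreeProj, Pi.zero_apply, coeff_zero]
  split_ifs with h
  · by_contra h1
    exact hb ((hx k m h1).symm.trans h)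
  · rfl

theorem monomial_smul_mem_gradedPiece {deg : ι → V →₀ ℕ} {b : V →₀ ℕ}
    {x : ι → MvPolynomial V K} (hx : x ∈ gradedPiece K deg b) (m : V →₀ ℕ) (a : K) :
    monomial m a • x ∈ gradedPiece K deg (m + b) := by
  classical
  intro k n h
  rw [Pi.smul_apply, smul_eq_mul, coeff_monomial_mul'] at h
  split_ifs at h with hmn
  · rw [← hx k (n - m) (right_ne_zero_of_mul h), ← add_assoc, add_tsub_cancel_of_le hmn]
  · exact absurd rfl h

theorem single_one_mem_gradedPiece [DecidableEq ι] (deg : ι → V →₀ ℕ) (k : ι) :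
    Pi.single k 1 ∈ gradedPiece K deg (deg k) := by
  classical
  intro l m h
  by_cases hl : l = k
  · subst hl
    rw [Pi.single_eq_same, coeff_one] at h
    split_ifs at h with hm
    · rw [← hm, zero_add]
    · exact absurd rfl h
  · simp [hl] at h

/-- A multigraded `A`-linear map commutes with the projections to the homogeneous parts. -/
theorem map_degreeProj [Finite ι] [DecidableEq ι] {deg : ι → V →₀ ℕ} {deg' : κ → V →₀ ℕ}
    (f : (ι → MvPolynomial V K) →ₗ[MvPolynomial V K] (κ → MvPolynomial V K))
    (hf : ∀ k, f (Pi.single k 1) ∈ gradedPiece K deg' (deg k)) (b : V →₀ ℕ)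
    (x : ι → MvPolynomial V K) :
    f (degreeProj K deg b x) = degreeProj K deg' b (f x) := by
  -- The projections are only `K`-linear, so the comparison is made over `K`, on monomial multiples
  -- of basis vectors.
  suffices h : (f.restrictScalars K).comp (degreeProj K deg b) =
      (degreeProj K deg' b).comp (f.restrictScalars K) from LinearMap.congr_fun h x
  refine LinearMap.pi_ext fun k p => ?_
  induction p using MvPolynomial.induction_on' with
  | add p q hp hq => rw [Pi.single_add, map_add, map_add, hp, hq]
  | monomial m a =>
    have hs : (Pi.single k (monomial m a) : ι → MvPolynomial V K) =
        monomial m a • Pi.single k 1 := by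
      rw [← Pi.single_smul', smul_eq_mul, mul_one]
    have h1 := monomial_smul_mem_gradedPiece (single_one_mem_gradedPiece (K := K) deg k) m a
    have h2 := monomial_smul_mem_gradedPiece (hf k) m a
    simp only [LinearMap.comp_apply, LinearMap.restrictScalars_apply, hs, map_smul]
    by_cases hb : m + deg k = b
    · subst hb
      rw [degreeProj_of_mem h1, degreeProj_of_mem h2, map_smul]
    · rw [degreeProj_of_mem_of_ne hb h1, degreeProj_of_mem_of_ne hb h2, map_zero]

theorem map_mem_gradedPiece [Finite ι] [DecidableEq ι] {deg : ι → V →₀ ℕ} {deg' : κ → V →₀ ℕ}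
    (f : (ι → MvPolynomial V K) →ₗ[MvPolynomial V K] (κ → MvPolynomial V K))
    (hf : ∀ k, f (Pi.single k 1) ∈ gradedPiece K deg' (deg k)) {b : V →₀ ℕ}
    {x : ι → MvPolynomial V K} (hx : x ∈ gradedPiece K deg b) : f x ∈ gradedPiece K deg' b := by
  rw [← degreeProj_of_mem hx, map_degreeProj f hf]
  exact degreeProj_mem _ _ _

variable (K) in
/-- The homogeneous part of multidegree `b` has one basis vector for each generator of multidegree
at most `b`. -/
noncomputable def gradedPieceEquiv (deg : ι → V →₀ ℕ) (b : V →₀ ℕ) :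
    gradedPiece K deg b ≃ₗ[K] ({k // deg k ≤ b} → K) where
  toFun x k := coeff (b - deg k) (x.1 k)
  map_add' x y := by ext k; simp
  map_smul' c x := by ext k; simp
  invFun c := by
    classical
    exact ⟨fun k => if h : deg k ≤ b then monomial (b - deg k) (c ⟨k, h⟩) else 0, by
      intro k m h
      dsimp only at h
      split_ifs at h with hk
      · rw [coeff_monomial] at h
        split_ifs at h with hm
        · rw [← hm, tsub_add_cancel_of_le hk]
        · exact absurd rfl h
      · simp at h⟩
  left_inv x := by
    classical
    ext k m
    by_cases hk : deg k ≤ b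
    · simp only [hk, dif_pos, coeff_monomial]
      split_ifs with hm
      · rw [hm]
      · by_contra h1
        refine hm ?_
        rw [← x.2 k m (Ne.symm h1), add_tsub_cancel_right]
    · simp only [hk, dif_neg, not_false_eq_true, coeff_zero]
      by_contra h1
      exact hk (x.2 k m (Ne.symm h1) ▸ le_add_self)
  right_inv c := by
    classical
    ext ⟨k, hk⟩
    dsimp only
    rw [dif_pos hk, coeff_monomial, if_pos rfl]

instance [Finite ι] (deg : ι → V →₀ ℕ) (b : V →₀ ℕ) :
    FiniteDimensional K (gradedPiece K deg b) :=
  Module.Finite.equiv (gradedPieceEquiv K deg b).symm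

theorem finrank_gradedPiece [Finite ι] (deg : ι → V →₀ ℕ) (b : V →₀ ℕ) :
    Module.finrank K (gradedPiece K deg b) = Nat.card {k // deg k ≤ b} := by
  have := Fintype.ofFinite {k // deg k ≤ b}
  rw [(gradedPieceEquiv K deg b).finrank_eq, Module.finrank_fintype_fun_eq_card,
    Nat.card_eq_fintype_card]

end GradedPiece

/-- Rank-nullity with the kernel kept in the ambient module, where exactness of a strand can rewrite
it as an image. -/
theorem Submodule.finrank_map_add_finrank_inf_ker {K M N : Type*} [Field K] [AddCommGroup M]
    [Module K M] [AddCommGroup N] [Module K N] (f : M →ₗ[K] N) (P : Submodule K M)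
    [FiniteDimensional K P] :
    Module.finrank K (P.map f) + Module.finrank K (P ⊓ LinearMap.ker f : Submodule K M) =
      Module.finrank K P := by
  rw [← LinearMap.finrank_range_add_finrank_ker (f.domRestrict P), LinearMap.range_domRestrict,
    LinearMap.ker_domRestrict, ← Submodule.map_comap_subtype P (LinearMap.ker f),
    ← (Submodule.equivMapOfInjective P.subtype P.subtype_injective _).finrank_eq]

/-- The ranks telescope: `c` holds the dimensions of a complex, `r` the ranks of its differentials,
`h` the dimension of the resolved space. -/
theorem sum_range_neg_one_pow_mul_of_eq_add {c r : ℕ → ℕ} {h : ℕ} (h0 : h + r 0 = c 0)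
    (hs : ∀ i, r i + r (i + 1) = c (i + 1)) (N : ℕ) :
    ∑ i ∈ Finset.range (N + 1), (-1 : ℤ) ^ i * (c i : ℤ) = h + (-1) ^ N * r N := by
  induction N with
  | zero => simp [← h0]
  | succ N ih =>
    rw [Finset.sum_range_succ, ih, ← hs N]
    push_cast
    ring

/-! ### Membership in the edge ideal -/

section EdgeIdeal

variable {V K : Type*} [Field K]

theorem FinHypergraph.mem_edgeIdeal_iff (H : FinHypergraph V) (p : MvPolynomial V K) :
    p ∈ H.edgeIdeal K ↔ ∀ m, coeff m p ≠ 0 → ∃ e ∈ H.edges, e ⊆ m.support := by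
  classical
  have hset : {f : MvPolynomial V K | ∃ e ∈ H.edges, f = ∏ v ∈ e, X v} =
      (fun s => monomial s (1 : K)) ''
        {s | ∃ e ∈ H.edges, s = ∑ v ∈ e, Finsupp.single v 1} := by
    ext f
    simp only [Set.mem_ofPred_eq, Set.mem_image]
    constructor
    · rintro ⟨e, he, rfl⟩
      exact ⟨_, ⟨e, he, rfl⟩, by rw [monomial_sum_one]; rfl⟩
    · rintro ⟨_, ⟨e, he, rfl⟩, rfl⟩
      exact ⟨e, he, by rw [monomial_sum_one]; rfl⟩
  rw [FinHypergraph.edgeIdeal, hset, mem_ideal_span_monomial_image]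
  simp only [mem_support_iff]
  refine forall₂_congr fun m _ => ?_
  simp only [Set.mem_ofPred_eq]
  constructor
  · rintro ⟨_, ⟨e, he, rfl⟩, hle⟩
    refine ⟨e, he, fun v hv => ?_⟩
    have := hle v
    simp only [Finsupp.finsetSum_apply, Finsupp.single_apply, Finset.sum_ite_eq', hv,
      if_true] at this
    simp only [Finsupp.mem_support_iff]
    omega
  · rintro ⟨e, he, hsub⟩
    refine ⟨_, ⟨e, he, rfl⟩, fun v => ?_⟩
    simp only [Finsupp.finsetSum_apply, Finsupp.single_apply, Finset.sum_ite_eq']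
    split_ifs with hv
    · exact Nat.one_le_iff_ne_zero.2 (Finsupp.mem_support_iff.1 (hsub hv))
    · exact Nat.zero_le _

end EdgeIdeal

/-! ### Euler characteristic of a strand -/

namespace MinimalFreeResolution

variable {V K : Type*} [Field K]

section

variable {I : Ideal (MvPolynomial V K)} (F : MinimalFreeResolution I)

theorem d_single_mem (i : ℕ) (k : Fin (F.rank (i + 1))) :
    F.d i (Pi.single k 1) ∈ gradedPiece K (F.deg i) (F.deg (i + 1) k) :=
  fun l m h => F.d_homogeneous i k l m (mem_support_iff.2 h)

/-- Any preimage can be projected to multidegree `b`, since the differential commutes with the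
projections. -/
theorem exists_d_eq_of_mem {i : ℕ} {b : V →₀ ℕ} {x : Fin (F.rank i) → MvPolynomial V K}
    (hx : x ∈ gradedPiece K (F.deg i) b) (hr : x ∈ LinearMap.range (F.d i)) :
    ∃ y ∈ gradedPiece K (F.deg (i + 1)) b, F.d i y = x := by
  obtain ⟨y, rfl⟩ := hr
  exact ⟨degreeProj K (F.deg (i + 1)) b y, degreeProj_mem _ _ _,
    by rw [map_degreeProj _ (F.d_single_mem i), degreeProj_of_mem hx]⟩

theorem gradedPiece_inf_ker_eq_map {P : Type*} [AddCommGroup P] [Module (MvPolynomial V K) P]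
    [Module K P] [IsScalarTower K (MvPolynomial V K) P] {i : ℕ}
    {f : (Fin (F.rank i) → MvPolynomial V K) →ₗ[MvPolynomial V K] P}
    (hf : Function.Exact (F.d i) f) (b : V →₀ ℕ) :
    gradedPiece K (F.deg i) b ⊓ LinearMap.ker (f.restrictScalars K) =
      (gradedPiece K (F.deg (i + 1)) b).map ((F.d i).restrictScalars K) := by
  ext x
  constructor
  · rintro ⟨hx, hk⟩
    obtain ⟨y, hy, rfl⟩ := F.exists_d_eq_of_mem hx ((hf x).1 hk)
    exact ⟨y, hy, rfl⟩
  · rintro ⟨y, hy, rfl⟩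
    exact ⟨map_mem_gradedPiece _ (F.d_single_mem i) hy, (hf _).2 ⟨y, rfl⟩⟩

end

variable {H : FinHypergraph V} (F : MinimalFreeResolution (H.edgeIdeal K))

/-- The augmentation maps the homogeneous part of multidegree `b` onto that of `A/I`. -/
theorem map_aug_gradedPiece (b : V →₀ ℕ) :
    (gradedPiece K (F.deg 0) b).map (F.aug.restrictScalars K) =
      Submodule.span K {Ideal.Quotient.mk (H.edgeIdeal K) (monomial b 1)} := by
  classical
  choose c hc using F.aug_homogeneous
  -- A multigraded lift of the augmentation to `A`, written as a free module over `Unit` with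
  -- generator in degree 0.
  let α : (Fin (F.rank 0) → MvPolynomial V K) →ₗ[MvPolynomial V K] (Unit → MvPolynomial V K) :=
    LinearMap.pi fun _ => Fintype.linearCombination (MvPolynomial V K)
      fun k => monomial (F.deg 0 k) (c k)
  have hα1 : ∀ k, α (Pi.single k 1) = fun _ => monomial (F.deg 0 k) (c k) := by
    intro k
    ext1 u
    simp [α, Fintype.linearCombination_apply_single]
  have hα : ∀ k, α (Pi.single k 1) ∈ gradedPiece K (fun _ : Unit => (0 : V →₀ ℕ)) (F.deg 0 k) := by
    intro k u m h
    rw [hα1, coeff_monomial] at h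
    split_ifs at h with hm
    · rw [hm, add_zero]
    · exact absurd rfl h
  have haug : ∀ x, F.aug x = Ideal.Quotient.mk (H.edgeIdeal K) (α x ()) := by
    intro x
    suffices h : F.aug = (Submodule.mkQ (H.edgeIdeal K)).comp ((LinearMap.proj ()).comp α) from
      LinearMap.congr_fun h x
    refine LinearMap.pi_ext' fun k => LinearMap.ext_ring ?_
    simp only [LinearMap.comp_apply, LinearMap.single_apply, hα1, LinearMap.proj_apply]
    exact hc k
  have hmon : ∀ p ∈ gradedPiece K (fun _ : Unit => (0 : V →₀ ℕ)) b,
      p () = (coeff b (p ())) • monomial b (1 : K) := by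
    intro p hp
    ext m
    rw [coeff_smul, coeff_monomial]
    split_ifs with hm
    · simp [hm]
    · rw [smul_zero]
      by_contra h1
      exact hm ((add_zero m).symm.trans (hp () m h1)).symm
  apply le_antisymm
  · rintro _ ⟨x, hx, rfl⟩
    rw [LinearMap.restrictScalars_apply, haug, hmon _ (map_mem_gradedPiece α hα hx)]
    exact Submodule.mem_span_singleton.2 ⟨_, rfl⟩
  · rw [Submodule.span_singleton_le_iff_mem]
    obtain ⟨y, hy⟩ := F.aug_surjective (Ideal.Quotient.mk (H.edgeIdeal K) (monomial b 1))
    refine ⟨degreeProj K (F.deg 0) b y, degreeProj_mem _ _ _, ?_⟩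
    rw [haug, Ideal.Quotient.mk_eq_mk_iff_sub_mem, FinHypergraph.mem_edgeIdeal_iff] at hy
    rw [LinearMap.restrictScalars_apply, haug, Ideal.Quotient.mk_eq_mk_iff_sub_mem,
      FinHypergraph.mem_edgeIdeal_iff, map_degreeProj α hα]
    intro m hm
    refine hy m fun h0 => hm ?_
    rw [coeff_sub, coeff_monomial] at h0 ⊢
    rw [coeff_degreeProj, add_zero]
    by_cases hb : m = b
    · rwa [if_pos hb]
    · rw [if_neg hb, if_neg (Ne.symm hb), sub_zero]

open Classical in
theorem finrank_map_aug_gradedPiece (b : V →₀ ℕ) :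
    Module.finrank K ((gradedPiece K (F.deg 0) b).map (F.aug.restrictScalars K)) =
      if ∃ e ∈ H.edges, e ⊆ b.support then 0 else 1 := by
  rw [map_aug_gradedPiece]
  have key : Ideal.Quotient.mk (H.edgeIdeal K) (monomial b 1) = 0 ↔
      ∃ e ∈ H.edges, e ⊆ b.support := by
    rw [Ideal.Quotient.eq_zero_iff_mem, FinHypergraph.mem_edgeIdeal_iff]
    constructor
    · intro h
      exact h b (by simp)
    · intro h m hm
      rw [coeff_monomial] at hm
      split_ifs at hm with hb
      · rwa [← hb]
      · exact absurd rfl hm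
  split_ifs with h
  · rw [key.2 h, Submodule.span_zero_singleton, finrank_bot]
  · exact finrank_span_singleton fun h0 => h (key.1 h0)

open Classical in
/-- The Euler characteristic of the strand of multidegree `b` of the resolution. -/
theorem sum_neg_one_pow_mul_card_deg_le (b : V →₀ ℕ) (N : ℕ)
    (hN : ∀ i, N ≤ i → ∀ k, ¬ F.deg i k ≤ b) :
    ∑ i ∈ Finset.range N, (-1 : ℤ) ^ i * (Nat.card {k // F.deg i k ≤ b} : ℤ) =
      if ∃ e ∈ H.edges, e ⊆ b.support then 0 else 1 := by
  have hzero : ∀ i, N ≤ i → Module.finrank K (gradedPiece K (F.deg i) b) = 0 := by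
    intro i hi
    rw [finrank_gradedPiece]
    have : IsEmpty {k // F.deg i k ≤ b} := ⟨fun k => hN i hi k.1 k.2⟩
    exact Nat.card_of_isEmpty
  let r : ℕ → ℕ := fun i =>
    Module.finrank K ((gradedPiece K (F.deg (i + 1)) b).map ((F.d i).restrictScalars K))
  have h0 := Submodule.finrank_map_add_finrank_inf_ker (F.aug.restrictScalars K)
    (gradedPiece K (F.deg 0) b)
  rw [F.gradedPiece_inf_ker_eq_map F.exact_zero, finrank_map_aug_gradedPiece] at h0
  have hs : ∀ i, r i + r (i + 1) = Module.finrank K (gradedPiece K (F.deg (i + 1)) b) := by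
    intro i
    have h := Submodule.finrank_map_add_finrank_inf_ker ((F.d i).restrictScalars K)
      (gradedPiece K (F.deg (i + 1)) b)
    rwa [F.gradedPiece_inf_ker_eq_map (F.exact_succ i)] at h
  have hsum := sum_range_neg_one_pow_mul_of_eq_add (r := r)
    (c := fun i => Module.finrank K (gradedPiece K (F.deg i) b)) h0 hs N
  -- The telescoped sum leaves a remainder `r N`, the rank of a map out of the zero space in
  -- homological degree `N + 1`.
  have hr : r N = 0 := by
    have := hs N
    rw [hzero (N + 1) (Nat.le_succ N)] at this
    omega
  rw [Finset.sum_range_succ, hzero N le_rfl, hr] at hsum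
  simp only [finrank_gradedPiece] at hsum
  simpa using hsum

end MinimalFreeResolution

/-! ### Signed counts of edge sets -/

namespace FinHypergraph

variable {V : Type*} [DecidableEq V] (H : FinHypergraph V)

/-- The alternating number of edge sets whose union is the support of the squarefree vector `a`. -/
noncomputable def signedCovers (a : V →₀ ℕ) : ℤ :=
  ∑ L ∈ H.edges.powerset with Finsupp.indicator (L.biUnion id) (fun _ _ => 1) = a,
    (-1 : ℤ) ^ L.card

theorem indicator_one_le_iff (s : Finset V) (b : V →₀ ℕ) :
    Finsupp.indicator s (fun _ _ => 1) ≤ b ↔ s ⊆ b.support := by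
  rw [Finsupp.le_def]
  refine forall_congr' fun v => ?_
  rw [Finsupp.indicator_apply, Finsupp.mem_support_iff]
  split_ifs with h <;> simp [h, Nat.one_le_iff_ne_zero]

/-- After exchanging the sums, `L` ranges over all subsets of the set of edges inside the support of
`b`; their signs cancel unless that set is empty. -/
theorem sum_signedCovers (b : V →₀ ℕ) :
    ∑ a ∈ Finset.Iic b, H.signedCovers a =
      if ∃ e ∈ H.edges, e ⊆ b.support then 0 else 1 := by
  simp only [signedCovers]
  have h1 : ∑ a ∈ Finset.Iic b, ∑ L ∈ H.edges.powerset with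
      Finsupp.indicator (L.biUnion id) (fun _ _ => 1) = a, (-1 : ℤ) ^ L.card =
      ∑ L ∈ {e ∈ H.edges | e ⊆ b.support}.powerset, (-1 : ℤ) ^ L.card := by
    simp only [Finset.sum_filter]
    rw [Finset.sum_comm]
    simp only [Finset.sum_ite_eq, Finset.mem_Iic, indicator_one_le_iff]
    rw [← Finset.sum_filter]
    refine Finset.sum_congr ?_ fun _ _ => rfl
    ext L
    simp only [Finset.mem_filter, Finset.mem_powerset, Finset.biUnion_subset, id,
      Finset.subset_iff (s₁ := L)]
    exact ⟨fun h e he => ⟨h.1 he, h.2 e he⟩, fun h => ⟨fun e he => (h he).1, fun e he => (h he).2⟩⟩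
  rw [h1, Finset.sum_powerset_neg_one_pow_card]
  simp only [Finset.filter_eq_empty_iff]
  by_cases h : ∃ e ∈ H.edges, e ⊆ b.support
  · rw [if_pos h, if_neg (by push Not; exact h)]
  · rw [if_neg h, if_pos (by push Not at h; exact fun e he => h e he)]

variable [Fintype V]

theorem theta_eq (i j : ℕ) :
    H.theta i j = (H.edges.powerset.filter
      fun L => (L.biUnion id).card = i ∧ L.card = j).card := by
  rw [theta]
  refine Finset.card_bij' (fun p _ => p.2) (fun L _ => (L.biUnion id, L)) ?_ ?_ ?_ ?_
  · rintro ⟨W, L⟩ h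
    simp only [Finset.mem_filter, Finset.mem_product] at h ⊢
    obtain ⟨⟨-, hL⟩, rfl, hi, hj⟩ := h
    exact ⟨hL, hi, hj⟩
  · intro L h
    simp only [Finset.mem_filter, Finset.mem_product] at h ⊢
    exact ⟨⟨Finset.mem_univ _, h.1⟩, trivial, h.2⟩
  · rintro ⟨W, L⟩ h
    simp only [Finset.mem_filter] at h
    rw [h.2.1]
  · intro L h
    rfl

theorem coeff_edgePolyNegOne (j : ℕ) :
    H.edgePolyNegOne.coeff j =
      ∑ k ∈ Finset.range (H.edges.card + 1), (-1 : ℤ) ^ k * (H.theta j k : ℤ) := by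
  have h1 : ∀ i k : ℕ, (((H.theta i k : Polynomial ℤ) * Polynomial.X ^ i * (-1) ^ k).coeff j) =
      if j = i then (-1) ^ k * (H.theta i k : ℤ) else 0 := by
    intro i k
    have : (H.theta i k : Polynomial ℤ) * Polynomial.X ^ i * (-1) ^ k =
        Polynomial.C ((-1) ^ k * (H.theta i k : ℤ)) * Polynomial.X ^ i := by
      simp only [map_mul, map_pow, map_neg, map_one, map_natCast]
      ring
    rw [this, Polynomial.coeff_C_mul_X_pow]
  simp only [edgePolyNegOne, edgePoly, map_sum, map_mul, map_pow, map_natCast, aeval_X,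
    Matrix.cons_val_zero, Matrix.cons_val_one, Polynomial.finsetSum_coeff, h1]
  rw [Finset.sum_comm]
  refine Finset.sum_congr rfl fun k _ => ?_
  rw [Finset.sum_ite_eq]
  split_ifs with hj
  · rfl
  · have : H.theta j k = 0 := by
      rw [theta_eq, Finset.card_eq_zero, Finset.filter_eq_empty_iff]
      rintro L - ⟨rfl, -⟩
      exact hj (Finset.mem_range_succ_iff.2 (Finset.card_le_univ _))
    simp [this]

theorem sum_signedCovers_finsuppAntidiag (j : ℕ) :
    ∑ a ∈ Finset.finsuppAntidiag (Finset.univ : Finset V) j, H.signedCovers a =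
      H.edgePolyNegOne.coeff j := by
  have h1 : ∑ a ∈ Finset.finsuppAntidiag (Finset.univ : Finset V) j, H.signedCovers a =
      ∑ L ∈ H.edges.powerset with (L.biUnion id).card = j, (-1 : ℤ) ^ L.card := by
    simp only [signedCovers, Finset.sum_filter]
    rw [Finset.sum_comm]
    refine Finset.sum_congr rfl fun L _ => ?_
    rw [Finset.sum_ite_eq]
    refine if_congr ?_ rfl rfl
    simp [Finset.mem_finsuppAntidiag, Finsupp.indicator_apply, -Finset.mem_biUnion]
  rw [h1, coeff_edgePolyNegOne,
    ← Finset.sum_fiberwise_of_maps_to (g := Finset.card) (t := Finset.range (H.edges.card + 1))]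
  · refine Finset.sum_congr rfl fun k _ => ?_
    rw [theta_eq, Finset.filter_filter]
    rw [Finset.sum_congr rfl (g := fun _ => (-1 : ℤ) ^ k)
      fun L hL => by rw [(Finset.mem_filter.1 hL).2.2]]
    rw [Finset.sum_const, nsmul_eq_mul, mul_comm]
  · intro L hL
    rw [Finset.mem_filter, Finset.mem_powerset] at hL
    exact Finset.mem_range_succ_iff.2 (Finset.card_le_card hL.1)

end FinHypergraph

/-! ### Möbius inversion and graded Betti numbers -/

namespace MinimalFreeResolution

variable {V K : Type*} [DecidableEq V] [Field K]

theorem card_deg_le_eq_sum {I : Ideal (MvPolynomial V K)} (F : MinimalFreeResolution I) (i : ℕ)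
    (b : V →₀ ℕ) :
    Nat.card {k // F.deg i k ≤ b} = ∑ a ∈ Finset.Iic b, F.multigradedBetti i a := by
  classical
  rw [Nat.card_eq_fintype_card, Fintype.card_subtype]
  rw [Finset.card_eq_sum_card_fiberwise (f := F.deg i) (t := Finset.Iic b)]
  · refine Finset.sum_congr rfl fun a ha => ?_
    rw [multigradedBetti, Finset.filter_filter]
    congr 1
    ext k
    simp only [Finset.mem_filter, Finset.mem_univ, true_and, and_iff_right_iff_imp]
    rintro rfl
    exact Finset.mem_Iic.1 ha
  · intro k hk
    simpa using hk

variable {H : FinHypergraph V} (F : MinimalFreeResolution (H.edgeIdeal K))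

/-- Multigraded form of the comparison of Betti numbers with edge-induced subhypergraphs. -/
theorem sum_multigradedBetti_eq_signedCovers (b : V →₀ ℕ) (N : ℕ)
    (hN : ∀ i, N ≤ i → ∀ k, ¬ F.deg i k ≤ b) :
    ∑ i ∈ Finset.range N, (-1 : ℤ) ^ i * (F.multigradedBetti i b : ℤ) = H.signedCovers b := by
  classical
  induction b using WellFoundedLT.induction with
  | ind b ih =>
    have h1 : ∑ a ∈ Finset.Iic b,
        ∑ i ∈ Finset.range N, (-1 : ℤ) ^ i * (F.multigradedBetti i a : ℤ) =
        ∑ a ∈ Finset.Iic b, H.signedCovers a := by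
      rw [H.sum_signedCovers, Finset.sum_comm]
      simp only [← Finset.mul_sum, ← Nat.cast_sum, ← card_deg_le_eq_sum]
      rw [F.sum_neg_one_pow_mul_card_deg_le b N hN]
      congr
    -- The terms below `b` agree by induction, so the terms at `b` agree.
    rw [← Finset.Iio_insert, Finset.sum_insert (by simp), Finset.sum_insert (by simp),
      Finset.sum_congr rfl fun a ha => ih a (Finset.mem_Iio.1 ha) fun i hi k hk =>
        hN i hi k (hk.trans (Finset.mem_Iio.1 ha).le)] at h1
    exact add_right_cancel h1

variable [Fintype V]

theorem betti_ne_zero {I : Ideal (MvPolynomial V K)} (F : MinimalFreeResolution I) (i : ℕ)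
    (k : Fin (F.rank i)) : F.betti i (∑ v, F.deg i k v) ≠ 0 := by
  intro h
  rw [betti, Finset.sum_eq_zero_iff] at h
  have := h (F.deg i k) (by simp [Finset.mem_finsuppAntidiag])
  rw [multigradedBetti, Finset.card_eq_zero, Finset.filter_eq_empty_iff] at this
  exact this (Finset.mem_univ k) rfl

/-- All `j' ≤ j` enter because the strand of a `b` with `|b| = j` involves every generator of
multidegree at most `b`. -/
theorem sum_betti_eq_coeff (j N : ℕ) (hN : ∀ i, N ≤ i → ∀ j' ≤ j, F.betti i j' = 0) :
    ∑ i ∈ Finset.range N, (-1 : ℤ) ^ i * (F.betti i j : ℤ) = H.edgePolyNegOne.coeff j := by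
  rw [← H.sum_signedCovers_finsuppAntidiag]
  simp only [betti, Nat.cast_sum, Finset.mul_sum]
  rw [Finset.sum_comm]
  refine Finset.sum_congr rfl fun b hb => ?_
  refine F.sum_multigradedBetti_eq_signedCovers b N fun i hi k hk => ?_
  rw [Finset.mem_finsuppAntidiag] at hb
  exact F.betti_ne_zero i k (hN i hi _ (hb.1 ▸ Finset.sum_le_sum fun v _ => hk v))

end MinimalFreeResolution

/-- The Betti table has `b_{ij}` in column `i` and row `j - i`, so an anti-diagonal is the set of
the entries `b_{ij}` with `j` fixed. -/
theorem proposition4p11 {V : Type*} [Fintype V] [DecidableEq V] {K : Type*} [Field K] [CharZero K]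
    (H : FinHypergraph V) (hn : 3 ≤ Fintype.card V)
    (F : MinimalFreeResolution (H.edgeIdeal K))
    (hF : ∀ j i i', F.betti i j ≠ 0 → F.betti i' j ≠ 0 → i = i') (j : ℕ) :
    H.edgePolyNegOne.coeff j =
        ∑ k ∈ Finset.range (H.edges.card + 1), (-1 : ℤ) ^ k * (H.theta j k : ℤ) ∧
      (∀ i, F.betti i j ≠ 0 →
        (F.betti i j : ℤ) = (-1) ^ i * H.edgePolyNegOne.coeff j ∧
        (F.betti i j : ℤ) = |H.edgePolyNegOne.coeff j|) ∧
      ((∀ i, F.betti i j = 0) → H.edgePolyNegOne.coeff j = 0) := by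
  -- Finite length is not part of the structure; the anti-diagonal hypothesis bounds the homological
  -- degrees for each `j'`, and the supremum over `j' ≤ j` serves as `N`.
  have hbound : ∀ j', ∃ n, ∀ i, n ≤ i → F.betti i j' = 0 := by
    intro j'
    by_cases h : ∃ i, F.betti i j' ≠ 0
    · obtain ⟨i, hi⟩ := h
      refine ⟨i + 1, fun i' hi' => ?_⟩
      by_contra h'
      have := hF j' i i' hi h'
      omega
    · push Not at h
      exact ⟨0, fun i _ => h i⟩
  choose n hn' using hbound
  have hcoeff := F.sum_betti_eq_coeff j ((Finset.range (j + 1)).sup n) fun i hi j' hj' =>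
    hn' j' i ((Finset.le_sup (Finset.mem_range_succ_iff.2 hj')).trans hi)
  refine ⟨H.coeff_edgePolyNegOne j, fun i hi => ?_, fun h => ?_⟩
  · have hmem : i ∈ Finset.range ((Finset.range (j + 1)).sup n) := by
      rw [Finset.mem_range]
      by_contra hle
      exact hi (hn' j i ((Finset.le_sup (Finset.self_mem_range_succ j)).trans (not_lt.1 hle)))
    rw [Finset.sum_eq_single_of_mem i hmem fun i' _ hne => by
      rw [not_not.1 fun h' => hne (hF j i' i h' hi), Nat.cast_zero, mul_zero]] at hcoeff
    rw [← hcoeff, ← mul_assoc, ← mul_pow, abs_mul, abs_pow, abs_neg, abs_one, one_pow, one_mul,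
      Nat.abs_cast]
    simp
  · rw [← hcoeff]
    simp [h]
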